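/- An overcubic partition is a partition into positive integers in which odd parts have one colour and even parts may appear in two colours, and in which the first occurrence of each (coloured) part may be overlined. Let $\overline{bt}(n)$ denote the number of overcubic partition triples of $n$, i.e. of ordered triples of overcubic partitions the sum of all of whose parts is $n$; equivalently, $$\sum_{n\ge 0}\overline{bt}(n)q^n=\prod_{i\ge 1}\frac{(1-q^{4i})^3}{(1-q^i)^6(1-q^{2i})^3}.$$ Then, for all $n\ge 0$, $$\overline{bt}(72n+21)\equiv 0 \pmod{128}\qquad\text{and}\qquad \overline{bt}(72n+69)\equiv 0\pmod{384}.$$ -/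

import Mathlib

/-- An overcubic partition: a finite multiset of positive parts in which odd parts occur in
one colour (`0`) and even parts in two colours (`0` and `1`), where for each distinct coloured
part that occurs, (the first instance of) that part may be overlined. A part is written as a
pair (value, colour), and `overlined` is the set of those coloured parts whose first instance
is overlined. -/
@[ext]
structure OvercubicPartition where
  parts : Multiset (ℕ × Fin 2)
  overlined : Finset (ℕ × Fin 2)
  parts_pos : ∀ p ∈ parts, 0 < p.1
  even_of_colour_one : ∀ p ∈ parts, p.2 = 1 → Even p.1
  overlined_subset : ∀ p ∈ overlined, p ∈ parts

/-- The number that is partitioned: the sum of the values of all parts. -/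
def OvercubicPartition.size (π : OvercubicPartition) : ℕ :=
  (π.parts.map Prod.fst).sum

/-- The number of overcubic partition triples of `n`: ordered triples of overcubic partitions
whose parts sum to `n` altogether. -/
noncomputable def bt (n : ℕ) : ℕ :=
  Nat.card {π : Fin 3 → OvercubicPartition // ∑ i, (π i).size = n}

open PowerSeries

/-! Write φ(q) = ∑ q^(i²) over all integers i, and P(q) for the overpartition series. Separating
colours gives the generating series (P(q)P(q²))³, and Gauss's theorem says P(q) = 1/φ(-q)
(`overpartitionSeries_mul`). Since φ(q)φ(-q) = φ(-q²)², we get P(q) = φ(q)P(q²)²; applied at q, q²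
and q⁴ this yields φ(q)³φ(q²)⁹φ(q⁴)¹⁸P(q⁸)³⁶ (`overcubicSeries_pow_three_eq`).

Modulo 128: let b and d be the sums of q^(m²) and q^(2m²) over positive odd m. Dissecting φ(q),
φ(q²) and φ(q⁴)² by parity leaves series whose exponents are known modulo 8, and the terms with
exponent 5 modulo 8 collapse to 39·32·b³d (`coeff_thetaProduct`). It remains to see that 4 divides
the coefficients of b³d at exponents 3 and 6 modulo 9. A dissection by 3, using the forms u² + 2v²
and u² + v² + w², shows that the terms in these classes cancel modulo 4
(`coeff_oddSquareSeries_cube_mul`).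

Modulo 3: P(q)P(q²) = φ(q)P(q²)³, and cubing is q ↦ q³, so the coefficient at 3m involves squares
congruent to m modulo 3; none exist for m ≡ 2 (`three_dvd_bt`). -/

/-- The generating series `∑ i, X ^ Q i` of an integer-valued weight `Q`. -/
noncomputable def theta (R : Type*) [CommRing R] {ι : Type*} (Q : ι → ℤ) : R⟦X⟧ :=
  PowerSeries.mk fun n => (Nat.card {i // Q i = n} : R)

/-- A weight is admissible if it is nonnegative and takes every value finitely often. -/
structure Admissible {ι : Type*} (Q : ι → ℤ) : Prop where
  nonneg : ∀ i, 0 ≤ Q i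
  finite : ∀ n : ℕ, Finite {i // Q i = n}

/-! ### Calculus of theta series: products, splittings, dilations -/

section Theta

variable {R : Type*} [CommRing R] {ι κ : Type*} {Q : ι → ℤ} {Q' : κ → ℤ}

theorem coeff_theta (Q : ι → ℤ) (n : ℕ) :
    coeff n (theta R Q) = (Nat.card {i // Q i = n} : R) := coeff_mk _ _

/-- Pairs of total weight `n`, sorted by the weights of their components. -/
noncomputable def fiberAddEquiv (hQ : ∀ i, 0 ≤ Q i) (hQ' : ∀ i, 0 ≤ Q' i) (n : ℕ) :
    {p : ι × κ // Q p.1 + Q' p.2 = n} ≃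
      Σ ab : Finset.HasAntidiagonal.antidiagonal n, {i // Q i = ab.1.1} × {j // Q' j = ab.1.2} where
  toFun p := ⟨⟨((Q p.1.1).toNat, (Q' p.1.2).toNat), by
      have := hQ p.1.1; have := hQ' p.1.2; have := p.2
      rw [Finset.HasAntidiagonal.mem_antidiagonal]; omega⟩,
    ⟨p.1.1, (Int.toNat_of_nonneg (hQ _)).symm⟩, ⟨p.1.2, (Int.toNat_of_nonneg (hQ' _)).symm⟩⟩
  invFun x := ⟨(x.2.1.1, x.2.2.1), by
    have h := Finset.HasAntidiagonal.mem_antidiagonal.1 x.1.2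
    have h1 := x.2.1.2; have h2 := x.2.2.2
    show Q x.2.1.1 + Q' x.2.2.1 = n
    omega⟩
  left_inv p := rfl
  right_inv := by
    rintro ⟨⟨⟨a, b⟩, h⟩, ⟨i, hi⟩, ⟨j, hj⟩⟩
    dsimp only at hi hj
    obtain rfl : a = (Q i).toNat := by omega
    obtain rfl : b = (Q' j).toNat := by omega
    rfl

theorem Admissible.add (hQ : Admissible Q) (hQ' : Admissible Q') :
    Admissible fun p : ι × κ => Q p.1 + Q' p.2 where
  nonneg p := add_nonneg (hQ.nonneg _) (hQ'.nonneg _)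
  finite n := by
    have := hQ.finite; have := hQ'.finite
    exact Finite.of_equiv _ (fiberAddEquiv hQ.nonneg hQ'.nonneg n).symm

theorem theta_mul (hQ : Admissible Q) (hQ' : Admissible Q') :
    theta R Q * theta R Q' = theta R fun p : ι × κ => Q p.1 + Q' p.2 := by
  ext n
  have := hQ.finite; have := hQ'.finite
  rw [coeff_theta, Nat.card_congr (fiberAddEquiv hQ.nonneg hQ'.nonneg n), Nat.card_sigma,
    coeff_mul, ← Finset.sum_coe_sort]
  simp [coeff_theta, Nat.card_prod]

theorem theta_congr (e : ι → κ) (he : e.Bijective) (h : ∀ i, Q' (e i) = Q i) :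
    theta R Q = theta R Q' := by
  ext n
  rw [coeff_theta, coeff_theta]
  congr 1
  exact Nat.card_congr ((Equiv.ofBijective e he).subtypeEquiv fun i => by
    rw [Equiv.ofBijective_apply, h])

theorem Admissible.comp_injective (hQ : Admissible Q) (e : κ → ι) (he : e.Injective) :
    Admissible fun j => Q (e j) where
  nonneg j := hQ.nonneg _
  finite n := by
    have := hQ.finite n
    exact Finite.of_injective (fun j : {j // Q (e j) = n} => (⟨e j.1, j.2⟩ : {i // Q i = n}))
      fun a b h => Subtype.ext (he (congrArg Subtype.val h))

theorem Admissible.const_mul (hQ : Admissible Q) {k : ℕ} (hk : k ≠ 0) :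
    Admissible fun i => (k : ℤ) * Q i where
  nonneg i := mul_nonneg (Int.natCast_nonneg k) (hQ.nonneg i)
  finite n := by
    refine Set.Finite.subset (hQ.finite (n / k)) fun i hi => ?_
    have hi' : (k : ℤ) * Q i = n := hi
    show Q i = (n / k : ℕ)
    rw [Int.natCast_div, ← hi', Int.mul_ediv_cancel_left _ (by exact_mod_cast hk)]

theorem theta_sum (hQ : Admissible Q) (hQ' : Admissible Q') :
    theta R (Sum.elim Q Q') = theta R Q + theta R Q' := by
  ext n
  have := hQ.finite n; have := hQ'.finite n
  rw [map_add, coeff_theta, coeff_theta, coeff_theta, ← Nat.cast_add, ← Nat.card_sum]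
  congr 1
  exact Nat.card_congr (Equiv.subtypeSum)

/-- A weight on `ι` whose index type is split into two parts. -/
theorem theta_split {α β : Type*} (hQ : Admissible Q) (f : α → ι) (g : β → ι)
    (h : (Sum.elim f g).Bijective) :
    theta R Q = theta R (fun a => Q (f a)) + theta R fun b => Q (g b) := by
  rw [← theta_sum (hQ.comp_injective f fun a b hab => Sum.inl_injective (h.1 hab))
    (hQ.comp_injective g fun a b hab => Sum.inr_injective (h.1 hab))]
  refine (theta_congr _ h ?_).symm
  rintro (a | b) <;> rfl

/-- A weight on `ι` whose index type is split into three parts. -/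
theorem theta_split₃ {α β γ : Type*} (hQ : Admissible Q) (f : α → ι) (g : β → ι) (k : γ → ι)
    (h : (Sum.elim f (Sum.elim g k)).Bijective) :
    theta R Q = theta R (fun a => Q (f a)) + theta R (fun b => Q (g b)) +
      theta R fun c => Q (k c) := by
  have hgk : (Sum.elim g k).Injective := fun a b hab => Sum.inr_injective (h.1 hab)
  rw [theta_split hQ f (Sum.elim g k) h, add_assoc,
    ← theta_sum (hQ.comp_injective g fun a b hab => Sum.inl_injective (hgk hab))
    (hQ.comp_injective k fun a b hab => Sum.inr_injective (hgk hab))]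
  congr 2
  funext x
  rcases x with a | b <;> rfl

theorem expand_theta (k : ℕ) (hk : k ≠ 0) (Q : ι → ℤ) :
    expand k hk (theta R Q) = theta R fun i => k * Q i := by
  ext n
  rw [coeff_expand]
  split_ifs with h
  · obtain ⟨m, rfl⟩ := h
    rw [Nat.mul_div_cancel_left _ (Nat.pos_of_ne_zero hk), coeff_theta, coeff_theta]
    congr 1
    refine Nat.card_congr (Equiv.subtypeEquivRight fun i => ?_)
    push_cast
    rw [mul_right_inj' (by exact_mod_cast hk)]
  · have : IsEmpty {i // (k : ℤ) * Q i = n} := ⟨fun i => h (by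
      have := i.2
      exact_mod_cast Dvd.intro _ this)⟩
    simp [coeff_theta]

theorem map_theta {S : Type*} [CommRing S] (f : R →+* S) (Q : ι → ℤ) :
    PowerSeries.map f (theta R Q) = theta S Q := by
  ext n
  rw [coeff_map, coeff_theta, coeff_theta, map_natCast]

end Theta

/-! ### Series supported on one residue class of exponents -/

/-- `f` only has terms whose exponent is `r` modulo `m`. -/
def SupportedMod {R : Type*} [CommRing R] (m : ℕ) (r : ZMod m) (f : R⟦X⟧) : Prop :=
  ∀ n : ℕ, (n : ZMod m) ≠ r → coeff n f = 0

namespace SupportedMod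

variable {R : Type*} [CommRing R] {m : ℕ} {r s : ZMod m} {f g : R⟦X⟧}

theorem mul (hf : SupportedMod m r f) (hg : SupportedMod m s g) :
    SupportedMod m (r + s) (f * g) := by
  intro n hn
  rw [coeff_mul]
  refine Finset.sum_eq_zero fun p hp => ?_
  by_cases h1 : (p.1 : ZMod m) = r
  · by_cases h2 : (p.2 : ZMod m) = s
    · exact absurd (by rw [← Finset.HasAntidiagonal.mem_antidiagonal.1 hp, Nat.cast_add, h1, h2]) hn
    · rw [hg _ h2, mul_zero]
  · rw [hf _ h1, zero_mul]

theorem add (hf : SupportedMod m r f) (hg : SupportedMod m r g) : SupportedMod m r (f + g) :=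
  fun n hn => by rw [map_add, hf n hn, hg n hn, add_zero]

theorem natCast (a : ℕ) : SupportedMod m 0 (a : R⟦X⟧) := fun n hn => by
  rw [← map_natCast (C (R := R)), coeff_C, if_neg (fun h => hn (by simp [h]))]

theorem pow (hf : SupportedMod m r f) (k : ℕ) : SupportedMod m (k * r) (f ^ k) := by
  induction k with
  | zero => simpa using natCast (R := R) (m := m) 1
  | succ k ih =>
    have := ih.mul hf
    rw [pow_succ]
    convert this using 1
    push_cast
    ring

theorem natCast_mul (a : ℕ) (hf : SupportedMod m r f) : SupportedMod m r ((a : R⟦X⟧) * f) := by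
  simpa using (natCast a).mul hf

theorem congr (hf : SupportedMod m r f) (h : r = s) : SupportedMod m s f := h ▸ hf

theorem theta {ι : Type*} {Q : ι → ℤ} (h : ∀ i, (Q i : ZMod m) = r) :
    SupportedMod m r (theta R Q) := fun n hn => by
  have : IsEmpty {i // Q i = n} := ⟨fun i => hn (by rw [← h i.1, i.2, Int.cast_natCast])⟩
  simp [coeff_theta]

theorem expand {k : ℕ} (hk : k ≠ 0) (hm : m ∣ k) : SupportedMod m 0 (expand k hk f) :=
  fun n hn => by
    rw [coeff_expand, if_neg]
    intro h
    exact hn ((ZMod.natCast_eq_zero_iff _ _).2 (hm.trans h))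

end SupportedMod

/-! ### The theta series in use and their 2-dissections -/

section ThetaSeries

variable (R : Type*) [CommRing R]

/-- `∑ i : ℤ, X ^ (k * i ^ 2)`. -/
noncomputable def squareSeries (k : ℕ) : R⟦X⟧ := theta R fun i : ℤ => k * i ^ 2

/-- `∑ i : ℤ, X ^ (k * (4 * i + 1) ^ 2)`, one term for every positive odd number. -/
noncomputable def oddSquareSeries (k : ℕ) : R⟦X⟧ := theta R fun i : ℤ => k * (4 * i + 1) ^ 2

/-- `∑ i : ℤ, X ^ (k * (2 * i + 1) ^ 2)`. -/
noncomputable def signedOddSquareSeries (k : ℕ) : R⟦X⟧ :=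
  theta R fun i : ℤ => k * (2 * i + 1) ^ 2

/-- `∑ i : ℤ, X ^ (k * (6 * i + 1) ^ 2)`, one term for every positive number prime to `6`. -/
noncomputable def primeToSixSquareSeries (k : ℕ) : R⟦X⟧ :=
  theta R fun i : ℤ => k * (6 * i + 1) ^ 2

/-- `∑ i : ℤ, X ^ (k * (3 * i + 1) ^ 2)`, one term for every positive number prime to `3`. -/
noncomputable def primeToThreeSquareSeries (k : ℕ) : R⟦X⟧ :=
  theta R fun i : ℤ => k * (3 * i + 1) ^ 2

/-- `∑ (x, y) : ℤ × ℤ, X ^ (k * (x ^ 2 + x * y + y ^ 2))`. -/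
noncomputable def hexagonalSeries (k : ℕ) : R⟦X⟧ :=
  theta R fun p : ℤ × ℤ => k * (p.1 ^ 2 + p.1 * p.2 + p.2 ^ 2)

/-- The part of the hexagonal series with `x - y = 3 * s + 1`, indexed by `(s, y)`. -/
noncomputable def shiftedHexagonalSeries (k : ℕ) : R⟦X⟧ :=
  theta R fun p : ℤ × ℤ => k * ((p.2 + 3 * p.1 + 1) ^ 2 + (p.2 + 3 * p.1 + 1) * p.2 + p.2 ^ 2)

variable {R}

theorem admissible_affine_sq {k : ℕ} (hk : 0 < k) {a : ℤ} (ha : 0 < a) (b : ℤ) :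
    Admissible fun i : ℤ => (k : ℤ) * (a * i + b) ^ 2 where
  nonneg i := by positivity
  finite n := by
    have hk' : (0 : ℤ) < k := by exact_mod_cast hk
    refine Set.Finite.subset (Set.finite_Icc (-(n + |b|) : ℤ) (n + |b|)) fun i hi => ?_
    have h1 : (k : ℤ) * (a * i + b) ^ 2 = n := hi
    have h2 : |a * i + b| ≤ n := by
      have : |a * i + b| ≤ (a * i + b) ^ 2 := by
        rw [← sq_abs (a * i + b)]
        exact Int.le_self_sq _
      nlinarith [sq_nonneg (a * i + b)]
    have h3 : |i| ≤ n + |b| := by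
      have h4 : |a * i| ≤ |a * i + b| + |b| := by
        simpa using abs_sub (a * i + b) b
      rw [abs_mul, abs_of_pos ha] at h4
      nlinarith [abs_nonneg i]
    exact abs_le.1 h3

theorem admissible_sq {k : ℕ} (hk : 0 < k) : Admissible fun i : ℤ => (k : ℤ) * i ^ 2 := by
  simpa using admissible_affine_sq hk one_pos 0

theorem admissible_hexagonal {k : ℕ} (hk : 0 < k) :
    Admissible fun p : ℤ × ℤ => (k : ℤ) * (p.1 ^ 2 + p.1 * p.2 + p.2 ^ 2) where
  nonneg p := by
    have : 0 ≤ p.1 ^ 2 + p.1 * p.2 + p.2 ^ 2 := by nlinarith [sq_nonneg (p.1 + p.2)]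
    positivity
  finite n := by
    have hk' : (1 : ℤ) ≤ k := by exact_mod_cast hk
    refine Set.Finite.subset ((Set.finite_Icc (-(2 * n) : ℤ) (2 * n)).prod
      (Set.finite_Icc (-(2 * n) : ℤ) (2 * n))) fun p hp => ?_
    have h1 : (k : ℤ) * (p.1 ^ 2 + p.1 * p.2 + p.2 ^ 2) = n := hp
    have h2 : p.1 ^ 2 + p.1 * p.2 + p.2 ^ 2 ≤ n := by
      nlinarith [sq_nonneg (p.1 + p.2), sq_nonneg p.1, sq_nonneg p.2]
    have h3 := Int.le_self_sq p.1
    have h4 := Int.le_self_sq p.2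
    have h5 := Int.le_self_sq (-p.1)
    have h6 := Int.le_self_sq (-p.2)
    refine ⟨⟨?_, ?_⟩, ⟨?_, ?_⟩⟩ <;> nlinarith [sq_nonneg (p.1 + p.2)]

theorem admissible_shiftedHexagonal {k : ℕ} (hk : 0 < k) : Admissible fun p : ℤ × ℤ =>
    (k : ℤ) * ((p.2 + 3 * p.1 + 1) ^ 2 + (p.2 + 3 * p.1 + 1) * p.2 + p.2 ^ 2) :=
  (admissible_hexagonal hk).comp_injective (fun p : ℤ × ℤ => (p.2 + 3 * p.1 + 1, p.2)) <| by
    rintro ⟨a, b⟩ ⟨c, d⟩ h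
    simp only [Prod.mk.injEq] at h ⊢
    omega

theorem signedOddSquareSeries_eq {k : ℕ} (hk : 0 < k) :
    signedOddSquareSeries R k = 2 * oddSquareSeries R k := by
  rw [signedOddSquareSeries, theta_split (admissible_affine_sq hk two_pos 1)
    (fun i : ℤ => 2 * i) (fun i : ℤ => -2 * i - 1), two_mul, oddSquareSeries]
  · congr 3 <;> funext i <;> ring
  · constructor
    · rintro (a | a) (b | b) h <;> simp only [Sum.elim_inl, Sum.elim_inr] at h <;> simp <;> omega
    · intro i
      rcases Int.even_or_odd' i with ⟨j, rfl | rfl⟩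
      · exact ⟨Sum.inl j, rfl⟩
      · exact ⟨Sum.inr (-j - 1), by simp only [Sum.elim_inr]; ring⟩

theorem squareSeries_eq {k : ℕ} (hk : 0 < k) :
    squareSeries R k = squareSeries R (4 * k) + 2 * oddSquareSeries R k := by
  rw [squareSeries, theta_split (admissible_sq hk)
    (fun i : ℤ => 2 * i) (fun i : ℤ => 2 * i + 1), ← signedOddSquareSeries_eq hk, squareSeries,
    signedOddSquareSeries]
  · congr 2
    funext i
    push_cast
    ring
  · constructor
    · rintro (a | a) (b | b) h <;> simp only [Sum.elim_inl, Sum.elim_inr] at h <;> simp <;> omega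
    · intro i
      rcases Int.even_or_odd' i with ⟨j, rfl | rfl⟩
      · exact ⟨Sum.inl j, rfl⟩
      · exact ⟨Sum.inr j, rfl⟩

/-- Rotate the square lattice by 45°: x + y and x - y have equal parity, and the two parities give
the two summands. -/
theorem squareSeries_sq {k : ℕ} (hk : 0 < k) :
    squareSeries R (2 * k) ^ 2 = squareSeries R (4 * k) ^ 2 + 4 * oddSquareSeries R k ^ 2 := by
  have h4 : 4 * oddSquareSeries R k ^ 2 = signedOddSquareSeries R k ^ 2 := by
    rw [signedOddSquareSeries_eq hk]; ring
  have hs := fun {j : ℕ} (hj : 0 < j) => admissible_sq hj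
  have ho := admissible_affine_sq hk two_pos 1
  rw [h4, sq, sq, sq, squareSeries, squareSeries, signedOddSquareSeries,
    theta_mul (hs (by omega)) (hs (by omega)), theta_mul (hs (by omega)) (hs (by omega)),
    theta_mul ho ho, theta_split ((hs (by omega)).add (hs (by omega)))
    (fun p : ℤ × ℤ => (p.1 + p.2, p.1 - p.2)) (fun p : ℤ × ℤ => (p.1 + p.2 + 1, p.1 - p.2))]
  · congr 2 <;> funext p <;> push_cast <;> ring
  · constructor
    · rintro (⟨a, b⟩ | ⟨a, b⟩) (⟨c, d⟩ | ⟨c, d⟩) h <;>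
        simp only [Sum.elim_inl, Sum.elim_inr, Prod.mk.injEq] at h <;> simp <;> omega
    · rintro ⟨x, y⟩
      rcases Int.even_or_odd' (x + y) with ⟨j, hj | hj⟩
      · exact ⟨Sum.inl (j, j - y), by simp only [Sum.elim_inl, Prod.mk.injEq]; omega⟩
      · exact ⟨Sum.inr (j, j - y), by simp only [Sum.elim_inr, Prod.mk.injEq]; omega⟩

/-- For u = 4x + 1 and v = 4y + 1, u² + v² = ((u - v)² + (u + v)²)/2, where u - v = 4t and u + v is
twice an odd number. -/
theorem oddSquareSeries_sq {k : ℕ} (hk : 0 < k) :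
    oddSquareSeries R k ^ 2 = squareSeries R (8 * k) * oddSquareSeries R (2 * k) := by
  have ho := fun {j : ℕ} (hj : 0 < j) => admissible_affine_sq hj four_pos 1
  rw [sq, oddSquareSeries, squareSeries, oddSquareSeries, theta_mul (ho hk) (ho hk),
    theta_mul (admissible_sq (by omega)) (ho (by omega))]
  -- Here t = x - y and 2(x + y) + 1 = ±(4l + 1); the parity of t, which is that of x + y, decides
  -- the sign.
  refine (theta_congr (fun p : ℤ × ℤ => if p.1 % 2 = 0 then
    ((2 * p.2 + p.1) / 2, (2 * p.2 - p.1) / 2) else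
    ((-2 * p.2 - 1 + p.1) / 2, (-2 * p.2 - 1 - p.1) / 2)) ?_ ?_).symm
  · constructor
    · rintro ⟨a, b⟩ ⟨c, d⟩ h
      simp only at h
      split_ifs at h <;> simp only [Prod.mk.injEq] at h ⊢ <;> omega
    · rintro ⟨x, y⟩
      rcases Int.even_or_odd' (x + y) with ⟨j, hj | hj⟩
      · refine ⟨(x - y, j), ?_⟩
        simp only
        split_ifs <;> simp only [Prod.mk.injEq] <;> omega
      · refine ⟨(x - y, -j - 1), ?_⟩
        simp only
        split_ifs <;> simp only [Prod.mk.injEq] <;> omega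
  · rintro ⟨t, l⟩
    rcases Int.even_or_odd' t with ⟨j, rfl | rfl⟩
    · have h0 : (2 * j) % 2 = 0 := by omega
      have h1 : (2 * l + 2 * j) / 2 = l + j := by omega
      have h2 : (2 * l - 2 * j) / 2 = l - j := by omega
      simp only [h0, if_true, h1, h2]
      push_cast
      ring
    · have h0 : ¬ (2 * j + 1) % 2 = 0 := by omega
      have h1 : (-2 * l - 1 + (2 * j + 1)) / 2 = j - l := by omega
      have h2 : (-2 * l - 1 - (2 * j + 1)) / 2 = -l - j - 1 := by omega
      simp only [h0, if_false, h1, h2]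
      push_cast
      ring

end ThetaSeries

/-! ### 3-dissections, and hexagonal series modulo 4 and 2 -/

section Dissections

variable {R : Type*} [CommRing R]

theorem oddSquareSeries_eq {k : ℕ} (hk : 0 < k) :
    oddSquareSeries R k = oddSquareSeries R (9 * k) + primeToSixSquareSeries R k := by
  have hbij : (fun i : ℤ => if i % 2 = 0 then 3 * (i / 2) else -3 * (i / 2) - 2).Injective := by
    intro a b h
    simp only at h
    split_ifs at h <;> omega
  -- The first map gives 4i + 1 = -3(4j + 1), the multiples of 3; the second gives ±(6j + 1), with
  -- sign + for even j.
  rw [oddSquareSeries, theta_split (admissible_affine_sq hk four_pos 1) (fun i : ℤ => -3 * i - 1)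
    (fun i : ℤ => if i % 2 = 0 then 3 * (i / 2) else -3 * (i / 2) - 2), oddSquareSeries,
    primeToSixSquareSeries]
  · congr 2
    · funext i; push_cast; ring
    · funext i
      rcases Int.even_or_odd' i with ⟨j, rfl | rfl⟩
      · rw [if_pos (by omega), show 2 * j / 2 = j by omega]; ring
      · rw [if_neg (by omega), show (2 * j + 1) / 2 = j by omega]; ring
  · constructor
    · rintro (a | a) (b | b) h <;> simp only [Sum.elim_inl, Sum.elim_inr] at h
      · simp; omega
      · split_ifs at h <;> omega
      · split_ifs at h <;> omega
      · rw [hbij h]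
    · intro i
      obtain h | h | h : i % 3 = 0 ∨ i % 3 = 1 ∨ i % 3 = 2 := by omega
      · refine ⟨Sum.inr (2 * (i / 3)), ?_⟩
        simp only [Sum.elim_inr]
        split_ifs <;> omega
      · refine ⟨Sum.inr (2 * (-(i + 2) / 3) + 1), ?_⟩
        simp only [Sum.elim_inr]
        split_ifs <;> omega
      · refine ⟨Sum.inl (-(i + 1) / 3), ?_⟩
        simp only [Sum.elim_inl]
        omega

/-- Division by a prime above 3 in ℤ[√-2]: u² + 2v² = 3(a² + 2b²) with a = (u + 2v)/3 and b = (u -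
v)/3, integral since u ≡ v modulo 3. For u = 6x + 1 and v = 6y + 1, b = 2(x - y) and a = 2(x + 2y) +
1; the three terms are the classes of x - y modulo 3. -/
theorem primeToSixSquareSeries_mul {k : ℕ} (hk : 0 < k) :
    primeToSixSquareSeries R k * primeToSixSquareSeries R (2 * k) =
      primeToSixSquareSeries R (3 * k) * squareSeries R (216 * k) +
      2 * oddSquareSeries R (27 * k) * primeToThreeSquareSeries R (24 * k) +
      primeToSixSquareSeries R (3 * k) * primeToThreeSquareSeries R (24 * k) := by
  have hw := fun {j : ℕ} (hj : 0 < j) => admissible_affine_sq hj (a := 6) (by norm_num) 1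
  have hv := fun {j : ℕ} (hj : 0 < j) => admissible_affine_sq hj three_pos 1
  rw [← signedOddSquareSeries_eq (by omega)]
  simp only [primeToSixSquareSeries, squareSeries, signedOddSquareSeries, primeToThreeSquareSeries]
  rw [theta_mul (hw hk) (hw (by omega)), theta_mul (hw (by omega)) (admissible_sq (by omega)),
    theta_mul (admissible_affine_sq (by omega) two_pos 1) (hv (by omega)),
    theta_mul (hw (by omega)) (hv (by omega)),
    theta_split₃ ((hw hk).add (hw (by omega)))
    (fun p : ℤ × ℤ => (p.1 + 2 * p.2, p.1 - p.2))
    (fun p : ℤ × ℤ => (p.1 + 2 * p.2 + 1, p.1 - p.2))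
    (fun p : ℤ × ℤ => (-p.1 - 2 * p.2 - 1, p.2 - p.1))]
  · congr 3 <;> funext p <;> push_cast <;> ring
  · constructor
    · rintro (⟨a, b⟩ | ⟨a, b⟩ | ⟨a, b⟩) (⟨c, d⟩ | ⟨c, d⟩ | ⟨c, d⟩) h <;>
        simp only [Sum.elim_inl, Sum.elim_inr, Prod.mk.injEq] at h <;> simp <;> omega
    · rintro ⟨x, y⟩
      obtain h | h | h : (x - y) % 3 = 0 ∨ (x - y) % 3 = 1 ∨ (x - y) % 3 = 2 := by omega
      · exact ⟨Sum.inl (y + (x - y) / 3, (x - y) / 3), by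
          simp only [Sum.elim_inl, Prod.mk.injEq]; omega⟩
      · exact ⟨Sum.inr (Sum.inl (y + (x - y) / 3, (x - y) / 3)), by
          simp only [Sum.elim_inl, Sum.elim_inr, Prod.mk.injEq]; omega⟩
      · exact ⟨Sum.inr (Sum.inr (-y + (y - x - 1) / 3, (y - x - 1) / 3)), by
          simp only [Sum.elim_inr, Prod.mk.injEq]; omega⟩

/-- Split (u, v, w) into its component along (1, 1, 1) and the orthogonal one. The former
contributes 3(2(x + y + z) + 1)², the latter 24 times the hexagonal form in the differences of x, y,
z. When 3 ∣ x + y + z these differences lie in a sublattice of index 3 on which the form is 3 times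
a hexagonal form, hence 72. -/
theorem primeToSixSquareSeries_pow_three {k : ℕ} (hk : 0 < k) :
    primeToSixSquareSeries R k ^ 3 =
      primeToSixSquareSeries R (3 * k) * hexagonalSeries R (72 * k) +
      2 * oddSquareSeries R (27 * k) * shiftedHexagonalSeries R (24 * k) +
      primeToSixSquareSeries R (3 * k) * shiftedHexagonalSeries R (24 * k) := by
  have hw := fun {j : ℕ} (hj : 0 < j) => admissible_affine_sq hj (a := 6) (by norm_num) 1
  have hs := admissible_shiftedHexagonal (k := 24 * k) (by omega)
  rw [← signedOddSquareSeries_eq (by omega), pow_three]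
  simp only [primeToSixSquareSeries, hexagonalSeries, signedOddSquareSeries,
    shiftedHexagonalSeries]
  rw [theta_mul (hw hk) (hw hk), theta_mul (hw hk) ((hw hk).add (hw hk)),
    theta_mul (hw (by omega)) (admissible_hexagonal (by omega)),
    theta_mul (admissible_affine_sq (by omega) two_pos 1) hs, theta_mul (hw (by omega)) hs,
    theta_split₃ ((hw hk).add ((hw hk).add (hw hk)))
    (fun p : ℤ × ℤ × ℤ => (p.1 + p.2.1 + p.2.2, p.1 - p.2.2, p.1 - p.2.1))
    (fun p : ℤ × ℤ × ℤ => (p.1 + 2 * p.2.1 + p.2.2 + 1, p.1 - p.2.1, p.1 - p.2.2 - p.2.1))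
    (fun p : ℤ × ℤ × ℤ =>
      (-p.1 + p.2.1 + p.2.2, -p.1 + p.2.1, -p.1 - p.2.2 - 2 * p.2.1 - 1))]
  · congr 3 <;> funext p <;> push_cast <;> ring
  · constructor
    · rintro (⟨a, b, c⟩ | ⟨a, b, c⟩ | ⟨a, b, c⟩) (⟨a', b', c'⟩ | ⟨a', b', c'⟩ | ⟨a', b', c'⟩) h <;>
        simp only [Sum.elim_inl, Sum.elim_inr, Prod.mk.injEq] at h <;> simp <;> omega
    · rintro ⟨x, y, z⟩
      obtain ⟨t, h | h | h⟩ : ∃ t, x + y + z = 3 * t ∨ x + y + z = 3 * t + 1 ∨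
          x + y + z = -3 * t - 1 := by
        obtain h | h | h : (x + y + z) % 3 = 0 ∨ (x + y + z) % 3 = 1 ∨ (x + y + z) % 3 = 2 := by
          omega
        · exact ⟨(x + y + z) / 3, by omega⟩
        · exact ⟨(x + y + z) / 3, by omega⟩
        · exact ⟨-(x + y + z + 1) / 3, by omega⟩
      · exact ⟨Sum.inl (t, t - z, t - y), by
          simp only [Sum.elim_inl, Prod.mk.injEq]; omega⟩
      · exact ⟨Sum.inr (Sum.inl (t, t - y, y - z)), by
          simp only [Sum.elim_inl, Sum.elim_inr, Prod.mk.injEq]; omega⟩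
      · exact ⟨Sum.inr (Sum.inr (t, y + t, x - y)), by
          simp only [Sum.elim_inr, Prod.mk.injEq]; omega⟩

/-- Vectors with y even give the form a² + 3b². An automorphism of the lattice exchanges the two
classes with y odd (x even or odd), and negation pairs off each class, so these contribute a
multiple of 4. -/
theorem hexagonalSeries_eq {k : ℕ} (hk : 0 < k) : ∃ f : R⟦X⟧,
    hexagonalSeries R k = squareSeries R k * squareSeries R (3 * k) + 4 * f := by
  refine ⟨theta R fun p : ℤ × ℤ =>
    k * ((2 * p.1) ^ 2 + 2 * p.1 * (4 * p.2 + 1) + (4 * p.2 + 1) ^ 2), ?_⟩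
  have hodd := (admissible_hexagonal hk).comp_injective
    (fun p : ℤ × ℤ => (2 * p.1, 2 * p.2 + 1)) <| by
      rintro ⟨a, b⟩ ⟨c, d⟩ h
      simp only [Prod.mk.injEq] at h ⊢
      omega
  have h2 : theta R (fun p : ℤ × ℤ =>
      (k : ℤ) * ((2 * p.1) ^ 2 + 2 * p.1 * (2 * p.2 + 1) + (2 * p.2 + 1) ^ 2)) =
      2 * theta R fun p : ℤ × ℤ =>
        (k : ℤ) * ((2 * p.1) ^ 2 + 2 * p.1 * (4 * p.2 + 1) + (4 * p.2 + 1) ^ 2) := by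
    rw [theta_split hodd (fun p : ℤ × ℤ => (p.1, 2 * p.2))
      (fun p : ℤ × ℤ => (-p.1, -2 * p.2 - 1)), two_mul]
    · congr 2 <;> funext p <;> ring
    · constructor
      · rintro (⟨a, b⟩ | ⟨a, b⟩) (⟨c, d⟩ | ⟨c, d⟩) h <;>
          simp only [Sum.elim_inl, Sum.elim_inr, Prod.mk.injEq] at h <;> simp <;> omega
      · rintro ⟨x, y⟩
        rcases Int.even_or_odd' y with ⟨j, hj | hj⟩
        · exact ⟨Sum.inl (x, j), by simp only [Sum.elim_inl, Prod.mk.injEq, true_and]; omega⟩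
        · exact ⟨Sum.inr (-x, -j - 1), by simp only [Sum.elim_inr, Prod.mk.injEq]; omega⟩
  rw [show (4 : R⟦X⟧) = 2 * 2 by norm_num, mul_assoc, ← h2, two_mul, ← add_assoc, hexagonalSeries,
    squareSeries, squareSeries, theta_mul (admissible_sq hk) (admissible_sq (by omega)),
    theta_split₃ (admissible_hexagonal hk) (fun p : ℤ × ℤ => (p.1 - p.2, 2 * p.2))
    (fun p : ℤ × ℤ => (2 * p.1, 2 * p.2 + 1))
    (fun p : ℤ × ℤ => (-2 * p.1 - 2 * p.2 - 1, 2 * p.2 + 1))]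
  · congr 3 <;> funext p <;> push_cast <;> ring
  · constructor
    · rintro (⟨a, b⟩ | ⟨a, b⟩ | ⟨a, b⟩) (⟨c, d⟩ | ⟨c, d⟩ | ⟨c, d⟩) h <;>
        simp only [Sum.elim_inl, Sum.elim_inr, Prod.mk.injEq] at h <;> simp <;> omega
    · rintro ⟨x, y⟩
      rcases Int.even_or_odd' y with ⟨j, hj | hj⟩
      · exact ⟨Sum.inl (x + j, j), by simp only [Sum.elim_inl, Prod.mk.injEq]; omega⟩
      · rcases Int.even_or_odd' x with ⟨i, hi | hi⟩
        · exact ⟨Sum.inr (Sum.inl (i, j)), by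
            simp only [Sum.elim_inl, Sum.elim_inr, Prod.mk.injEq]; omega⟩
        · exact ⟨Sum.inr (Sum.inr (-i - j - 1, j)), by
            simp only [Sum.elim_inr, Prod.mk.injEq]; omega⟩

/-- The reflection (x, y) ↦ (-y, -x) preserves both the form and x - y. Its fixed points have x =
-y, where the form is y²; all other points come in pairs. -/
theorem shiftedHexagonalSeries_eq {k : ℕ} (hk : 0 < k) : ∃ f : R⟦X⟧,
    shiftedHexagonalSeries R k = primeToThreeSquareSeries R k + 2 * f := by
  refine ⟨theta R fun p : {p : ℤ × ℤ // 0 < 2 * p.2 + 3 * p.1 + 1} =>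
    k * ((p.1.2 + 3 * p.1.1 + 1) ^ 2 + (p.1.2 + 3 * p.1.1 + 1) * p.1.2 + p.1.2 ^ 2), ?_⟩
  rw [shiftedHexagonalSeries, primeToThreeSquareSeries,
    -- With x = y + 3s + 1, the sign of x + y = 2y + 3s + 1 separates fixed points and the two
    -- halves.
    theta_split₃ (admissible_shiftedHexagonal hk) (fun i : ℤ => (-2 * i - 1, 3 * i + 1))
    (fun p : {p : ℤ × ℤ // 0 < 2 * p.2 + 3 * p.1 + 1} => p.1)
    (fun p : {p : ℤ × ℤ // 0 < 2 * p.2 + 3 * p.1 + 1} => (p.1.1, -p.1.2 - 3 * p.1.1 - 1)),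
    two_mul, ← add_assoc]
  · congr 3 <;> funext p <;> ring
  · constructor
    · rintro (a | ⟨⟨a, b⟩, hab⟩ | ⟨⟨a, b⟩, hab⟩) (c | ⟨⟨c, d⟩, hcd⟩ | ⟨⟨c, d⟩, hcd⟩) h <;>
        simp only [Sum.elim_inl, Sum.elim_inr, Prod.mk.injEq] at h <;> simp <;>
        (try simp only at *) <;> omega
    · rintro ⟨s, y⟩
      obtain h | h | h := lt_trichotomy (2 * y + 3 * s + 1) 0
      · exact ⟨Sum.inr (Sum.inr ⟨(s, -y - 3 * s - 1), show 0 < 2 * (-y - 3 * s - 1) + 3 * s + 1 by omega⟩), by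
          simp only [Sum.elim_inr, Prod.mk.injEq, true_and]; omega⟩
      · exact ⟨Sum.inl ((y - 1) / 3), by simp only [Sum.elim_inl, Prod.mk.injEq]; omega⟩
      · exact ⟨Sum.inr (Sum.inl ⟨(s, y), h⟩), rfl⟩

end Dissections

/-! ### The coefficients of b³d modulo 4 -/

section ModFour

variable {R : Type*} [CommRing R]

theorem squareSeries_eq_one_add {k : ℕ} (hk : 0 < k) :
    squareSeries R k = 1 + 2 * theta R fun n : ℕ => (k : ℤ) * ((n : ℤ) + 1) ^ 2 := by
  have h1 : theta R (fun _ : Unit => (k : ℤ) * 0 ^ 2) = 1 := by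
    ext n
    rw [coeff_theta, coeff_one]
    split_ifs with h
    · subst h; simp
    · have : IsEmpty {i : Unit // (k : ℤ) * 0 ^ 2 = n} := ⟨fun i => h (by simpa using i.2.symm)⟩
      rw [Nat.card_of_isEmpty, Nat.cast_zero]
  rw [squareSeries, theta_split₃ (admissible_sq hk) (fun _ : Unit => 0)
    (fun n : ℕ => (n : ℤ) + 1) (fun n : ℕ => -((n : ℤ) + 1)), h1, two_mul, ← add_assoc]
  · simp only [neg_sq]
  · constructor
    · rintro (a | a | a) (b | b | b) h <;> simp only [Sum.elim_inl, Sum.elim_inr] at h <;>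
        simp <;> omega
    · intro i
      obtain h | h | h := lt_trichotomy i 0
      · exact ⟨Sum.inr (Sum.inr (-i - 1).toNat), by simp only [Sum.elim_inr]; omega⟩
      · exact ⟨Sum.inl (), h.symm⟩
      · exact ⟨Sum.inr (Sum.inl (i - 1).toNat), by
          simp only [Sum.elim_inl, Sum.elim_inr]; omega⟩

/-- The three brackets have exponents 0 modulo 9, 2 modulo 3 and 1 modulo 3. The missing terms are
o18·w3·(3φ(q⁷²)φ(q²¹⁶) + hexagonal) and 2·o18·o27·(3φ(q⁷²)v + shifted hexagonal). Both vanish modulo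
4, because the hexagonal series is φ(q⁷²)φ(q²¹⁶) modulo 4, while modulo 2 the shifted one is v and
φ(q⁷²) is 1. -/
theorem oddSquareSeries_cube_mul_eq : ∃ f : R⟦X⟧,
    oddSquareSeries R 1 ^ 3 * oddSquareSeries R 2 =
      (oddSquareSeries R 9 ^ 3 * oddSquareSeries R 18 +
        (3 : ℕ) * (oddSquareSeries R 9 ^ 2 *
          (primeToSixSquareSeries R 3 * primeToThreeSquareSeries R 24)) +
        oddSquareSeries R 18 * (primeToSixSquareSeries R 3 * shiftedHexagonalSeries R 24)) +
      (oddSquareSeries R 9 ^ 3 * primeToSixSquareSeries R 2 +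
        (3 : ℕ) * (oddSquareSeries R 9 * primeToSixSquareSeries R 1 ^ 2 * oddSquareSeries R 18) +
        primeToSixSquareSeries R 1 ^ 3 * primeToSixSquareSeries R 2) +
      ((3 : ℕ) * (oddSquareSeries R 9 ^ 2 * primeToSixSquareSeries R 1 * oddSquareSeries R 18) +
        (3 : ℕ) * (oddSquareSeries R 9 * primeToSixSquareSeries R 1 ^ 2 *
          primeToSixSquareSeries R 2)) + 4 * f := by
  obtain ⟨s, hs⟩ : ∃ s, squareSeries R 72 = 1 + 2 * s := ⟨_, squareSeries_eq_one_add (by norm_num)⟩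
  obtain ⟨f, hf⟩ := hexagonalSeries_eq (R := R) (k := 72) (by norm_num)
  obtain ⟨g, hg⟩ := shiftedHexagonalSeries_eq (R := R) (k := 24) (by norm_num)
  have h1 := oddSquareSeries_eq (R := R) (k := 1) one_pos
  have h2 := oddSquareSeries_eq (R := R) (k := 2) two_pos
  have h3 := primeToSixSquareSeries_mul (R := R) (k := 1) one_pos
  have h4 := primeToSixSquareSeries_pow_three (R := R) (k := 1) one_pos
  have h5 := oddSquareSeries_sq (R := R) (k := 9) (by norm_num)
  norm_num at hf h1 h2 h3 h4 h5
  set o9 := oddSquareSeries R 9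
  set o18 := oddSquareSeries R 18
  set o27 := oddSquareSeries R 27
  set w1 := primeToSixSquareSeries R 1
  set w2 := primeToSixSquareSeries R 2
  set w3 := primeToSixSquareSeries R 3
  set v := primeToThreeSquareSeries R 24
  set t := squareSeries R 216
  refine ⟨o18 * (w3 * (1 + 2 * s) * t + w3 * f + o27 * v * (2 + 3 * s) + o27 * g), ?_⟩
  rw [h1, h2]
  push_cast
  rw [hf, hs, hg] at h4
  rw [hs] at h5
  rw [hg]
  linear_combination 3 * o9 ^ 2 * h3 + o18 * h4 + 3 * (w3 * t + 2 * o27 * v) * h5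

theorem coeff_oddSquareSeries_cube_mul (h4 : (4 : R) = 0) {n : ℕ}
    (hn : (n : ZMod 9) = 3 ∨ (n : ZMod 9) = 6) :
    coeff n (oddSquareSeries R 1 ^ 3 * oddSquareSeries R 2) = 0 := by
  have hn9 : (n : ZMod 9) ≠ 0 := by rcases hn with h | h <;> rw [h] <;> decide
  have hn3 : (n : ZMod 3) = 0 := by
    have h3 : 3 ∣ n := by
      have h9 : (9 : ℕ) ∣ n * 3 := by
        rw [← ZMod.natCast_eq_zero_iff]
        rcases hn with h | h <;> push_cast <;> rw [h] <;> decide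
      omega
    exact (ZMod.natCast_eq_zero_iff _ _).2 h3
  have ho9 : SupportedMod 9 0 (oddSquareSeries R 9) := .theta fun i => by
    push_cast; generalize (i : ZMod 9) = x; revert x; decide
  have ho18 : SupportedMod 9 0 (oddSquareSeries R 18) := .theta fun i => by
    push_cast; generalize (i : ZMod 9) = x; revert x; decide
  have hw3 : SupportedMod 9 3 (primeToSixSquareSeries R 3) := .theta fun i => by
    push_cast; generalize (i : ZMod 9) = x; revert x; decide
  have hv : SupportedMod 9 6 (primeToThreeSquareSeries R 24) := .theta fun i => by
    push_cast; generalize (i : ZMod 9) = x; revert x; decide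
  have hl : SupportedMod 9 6 (shiftedHexagonalSeries R 24) := .theta fun i => by
    push_cast; generalize (i.1 : ZMod 9) = x; generalize (i.2 : ZMod 9) = y; revert x y; decide
  have ho9' : SupportedMod 3 0 (oddSquareSeries R 9) := .theta fun i => by
    push_cast; generalize (i : ZMod 3) = x; revert x; decide
  have ho18' : SupportedMod 3 0 (oddSquareSeries R 18) := .theta fun i => by
    push_cast; generalize (i : ZMod 3) = x; revert x; decide
  have hw1 : SupportedMod 3 1 (primeToSixSquareSeries R 1) := .theta fun i => by
    push_cast; generalize (i : ZMod 3) = x; revert x; decide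
  have hw2 : SupportedMod 3 2 (primeToSixSquareSeries R 2) := .theta fun i => by
    push_cast; generalize (i : ZMod 3) = x; revert x; decide
  obtain ⟨f, hf⟩ := oddSquareSeries_cube_mul_eq (R := R)
  have hf4 : (4 : R⟦X⟧) * f = 0 := by
    rw [show (4 : R⟦X⟧) = C (4 : R) from (map_ofNat _ 4).symm, h4, map_zero, zero_mul]
  rw [hf, hf4, add_zero, map_add, map_add]
  have e1 := ((((ho9.pow 3).mul ho18).congr (by decide)).add
    (((ho9.pow 2).mul (hw3.mul hv)).natCast_mul 3 |>.congr (by decide))).add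
    ((ho18.mul (hw3.mul hl)).congr (by decide)) n hn9
  have e2 := ((((ho9'.pow 3).mul hw2).congr (s := 2) (by decide)).add
    (((ho9'.mul (hw1.pow 2)).mul ho18').natCast_mul 3 |>.congr (by decide))).add
    (((hw1.pow 3).mul hw2).congr (by decide)) n (by rw [hn3]; decide)
  have e3 := ((((ho9'.pow 2).mul hw1).mul ho18').natCast_mul 3 |>.congr (s := 1) (by decide)).add
    (((ho9'.mul (hw1.pow 2)).mul hw2).natCast_mul 3 |>.congr (by decide)) n (by rw [hn3]; decide)
  rw [e1, e2, e3, add_zero, add_zero]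

end ModFour

/-! ### Gauss's theorem for the overpartition series -/

section Gauss

variable {R : Type*} [CommRing R]

/-- A telescoping identity behind the finite form of Gauss's theorem on squares. -/
theorem gauss_telescope (q Q : R) (g h G : ℕ → R) (hh : ∀ s, h s * (1 - q ^ (s + 1)) = 1)
    (hg : ∀ s, g s = (1 + q ^ (s + 1)) * h s) (hG0 : G 0 = 1) (hG : ∀ s, G (s + 1) = G s * g s)
    (m : ℕ) :
    (1 + Q) * (1 + 2 * ∑ s ∈ Finset.range m, (-1) ^ (s + 1) * Q ^ (s + 1) * (h s * G s)) -
      (1 - Q) * (1 + 2 * ∑ s ∈ Finset.range m,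
        (-1) ^ (s + 1) * (Q * q) ^ (s + 1) * (h s * G s)) =
      2 * (-1) ^ m * Q ^ (m + 1) * G m := by
  induction m with
  | zero => simp [hG0]; ring
  | succ m ih =>
    rw [Finset.sum_range_succ, Finset.sum_range_succ, hG, hg]
    linear_combination ih + 2 * (-1) ^ (m + 1) * Q ^ (m + 1) * G m * hh m

/-- Shanks's finite form of Gauss's theorem on squares. -/
theorem gauss_finite (q : R) (g h G : ℕ → R) (hh : ∀ s, h s * (1 - q ^ (s + 1)) = 1)
    (hg : ∀ s, g s = (1 + q ^ (s + 1)) * h s) (hG0 : G 0 = 1) (hG : ∀ s, G (s + 1) = G s * g s)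
    (n : ℕ) :
    (1 + 2 * ∑ k ∈ Finset.range n, (-1) ^ (k + 1) * q ^ (k + 1) ^ 2) * G n =
      1 + 2 * ∑ s ∈ Finset.range n, (-1) ^ (s + 1) * (q ^ (n + 1)) ^ (s + 1) * (h s * G s) := by
  induction n with
  | zero => simp [hG0]
  | succ n ih =>
    have ht := gauss_telescope q (q ^ (n + 1)) g h G hh hg hG0 hG (n + 1)
    have e : q ^ (n + 1 + 1) = q ^ (n + 1) * q := pow_succ _ _
    rw [e]
    have h1 : (1 + 2 * ∑ k ∈ Finset.range (n + 1), (-1) ^ (k + 1) * q ^ (k + 1) ^ 2) * G (n + 1) =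
        g n * (1 + 2 * ∑ s ∈ Finset.range n,
          (-1) ^ (s + 1) * (q ^ (n + 1)) ^ (s + 1) * (h s * G s)) +
        2 * (-1) ^ (n + 1) * q ^ (n + 1) ^ 2 * G (n + 1) := by
      rw [Finset.sum_range_succ, ← ih, hG]
      ring
    rw [h1]
    rw [Finset.sum_range_succ] at ht
    rw [hG, hg] at ht ⊢
    set Y := ∑ s ∈ Finset.range (n + 1),
      (-1) ^ (s + 1) * (q ^ (n + 1) * q) ^ (s + 1) * (h s * G s)
    set Z := ∑ s ∈ Finset.range n, (-1) ^ (s + 1) * (q ^ (n + 1)) ^ (s + 1) * (h s * G s)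
    have hq : q ^ (n + 1) ^ 2 = (q ^ (n + 1)) ^ (n + 1) := by rw [sq, pow_mul]
    rw [hq]
    set Q := q ^ (n + 1)
    linear_combination h n * ht + (1 + 2 * Y) * hh n -
      2 * (-1) ^ (n + 1) * Q ^ (n + 1) * (1 + Q) * h n * G n * hh n

/-- The generating function of overpartitions. -/
noncomputable def overpartitionSeries : ℤ⟦X⟧ := Nat.Partition.genFun fun _ _ => (2 : ℤ)

open scoped PowerSeries.WithPiTopology in
-- A part size i contributes 1 + 2∑ q^(ij) over j ≥ 1, which equals (1 + q^i)/(1 - q^i).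
theorem tendsto_prod_overpartitionSeries :
    Filter.Tendsto (fun n => ∏ i ∈ Finset.range n,
      ((1 + (X : ℤ⟦X⟧) ^ (i + 1)) * ∑' j, (X ^ (i + 1)) ^ j)) Filter.atTop
      (nhds overpartitionSeries) := by
  refine (Nat.Partition.hasProd_genFun fun _ _ => (2 : ℤ)).tendsto_prod_nat.congr fun n =>
    Finset.prod_congr rfl fun i _ => ?_
  have h0 : ((X : ℤ⟦X⟧) ^ (i + 1)).constantCoeff = 0 := by simp
  have hs := WithPiTopology.summable_pow_of_constantCoeff_eq_zero h0
  have h1 : ∑' j, ((X : ℤ⟦X⟧) ^ (i + 1)) ^ j = 1 + ∑' j, ((X : ℤ⟦X⟧) ^ (i + 1)) ^ (j + 1) := by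
    rw [hs.tsum_eq_zero_add, pow_zero]
  have h3 := WithPiTopology.one_sub_mul_tsum_pow_of_constantCoeff_eq_zero h0
  trans 1 + 2 * ∑' j, ((X : ℤ⟦X⟧) ^ (i + 1)) ^ (j + 1)
  · rw [← ((summable_nat_add_iff 1).2 hs).tsum_mul_left]
    congr 1
    refine tsum_congr fun j => ?_
    rw [← pow_mul, smul_eq_C_mul]
    norm_num
  · linear_combination h3 - 2 * h1

open scoped PowerSeries.WithPiTopology in
theorem hasSum_theta {ι : Type*} {Q : ι → ℤ} (hQ : Admissible Q) :
    HasSum (fun i => (X : ℤ⟦X⟧) ^ (Q i).toNat) (theta ℤ Q) := by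
  rw [WithPiTopology.hasSum_iff_hasSum_coeff]
  intro n
  have hfin : {i | Q i = n}.Finite := hQ.finite n
  have h : HasSum (fun i => coeff n ((X : ℤ⟦X⟧) ^ (Q i).toNat)) _ :=
    hasSum_sum_of_ne_finset_zero (s := hfin.toFinset) fun i hi => by
      have := hQ.nonneg i
      have hi' : Q i ≠ n := by simpa using hi
      rw [coeff_X_pow, if_neg]
      omega
  suffices hsum : coeff n (theta ℤ Q) =
      ∑ i ∈ hfin.toFinset, coeff n ((X : ℤ⟦X⟧) ^ (Q i).toNat) by rwa [hsum]
  rw [coeff_theta, Finset.sum_congr rfl (g := fun _ => 1), Finset.sum_const, nsmul_one,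
    Nat.cast_inj]
  · exact Nat.card_eq_card_finite_toFinset hfin
  · intro i hi
    have hi' : Q i = n := by simpa using hi
    rw [coeff_X_pow, if_pos]
    omega

theorem signedOddSquareSeries_eq_two_mul {R : Type*} [CommRing R] {k : ℕ} (hk : 0 < k) :
    signedOddSquareSeries R k = 2 * theta R fun n : ℕ => (k : ℤ) * (2 * (n : ℤ) + 1) ^ 2 := by
  rw [signedOddSquareSeries, theta_split (admissible_affine_sq hk two_pos 1)
    (fun n : ℕ => (n : ℤ)) (fun n : ℕ => -(n : ℤ) - 1), two_mul]
  · congr 2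
    funext n
    ring
  · constructor
    · rintro (a | a) (b | b) h <;> simp only [Sum.elim_inl, Sum.elim_inr] at h <;> simp <;> omega
    · intro i
      obtain h | h := lt_or_ge i 0
      · exact ⟨Sum.inr (-i - 1).toNat, by simp only [Sum.elim_inr]; omega⟩
      · exact ⟨Sum.inl i.toNat, by simp only [Sum.elim_inl]; omega⟩

open scoped PowerSeries.WithPiTopology in
theorem tendsto_alternating_squares :
    Filter.Tendsto (fun n => 1 + 2 * ∑ k ∈ Finset.range n, (-1) ^ (k + 1) * (X : ℤ⟦X⟧) ^ (k + 1) ^ 2)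
      Filter.atTop (nhds (squareSeries ℤ 4 - 2 * oddSquareSeries ℤ 1)) := by
  rw [← signedOddSquareSeries_eq one_pos, signedOddSquareSeries_eq_two_mul one_pos,
    squareSeries_eq_one_add four_pos, add_sub_assoc, ← mul_sub]
  refine (Filter.Tendsto.const_mul 2 (HasSum.tendsto_sum_nat ?_)).const_add 1
  rw [sub_eq_neg_add]
  -- The summation index is one less than the root of the square: even indices give the odd squares,
  -- with sign -.
  refine HasSum.even_add_odd ?_ ?_
  · have h := hasSum_theta ((admissible_affine_sq one_pos two_pos 1).comp_injective
      (fun n : ℕ => (n : ℤ)) Nat.cast_injective)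
    have hterm : ∀ j : ℕ, (-1) ^ (2 * j + 1) * (X : ℤ⟦X⟧) ^ (2 * j + 1) ^ 2 =
        -X ^ (((1 : ℕ) : ℤ) * (2 * (j : ℤ) + 1) ^ 2).toNat := fun j => by
      rw [Odd.neg_one_pow ⟨j, rfl⟩, neg_one_mul]
      congr 2
      zify
      rw [Int.toNat_of_nonneg (by positivity)]
      ring
    simpa only [hterm] using h.neg
  · have h := hasSum_theta ((admissible_affine_sq four_pos one_pos 1).comp_injective
      (fun n : ℕ => (n : ℤ)) Nat.cast_injective)
    convert h using 2 with j
    · rw [Even.neg_one_pow ⟨j + 1, by ring⟩, one_mul]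
      congr 1
      zify
      rw [Int.toNat_of_nonneg (by positivity)]
      ring
    · simp only [one_mul]

open scoped PowerSeries.WithPiTopology in
/-- Gauss's theorem: the overpartition series is the inverse of `∑ i : ℤ, (-1) ^ i * X ^ i ^ 2`. -/
theorem overpartitionSeries_mul :
    (squareSeries ℤ 4 - 2 * oddSquareSeries ℤ 1) * overpartitionSeries = 1 := by
  have h := tendsto_alternating_squares.mul tendsto_prod_overpartitionSeries
  refine tendsto_nhds_unique h ?_
  rw [WithPiTopology.tendsto_iff_coeff_tendsto]
  intro d
  refine tendsto_atTop_of_eventually_const (i₀ := d) fun n hn => ?_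
  rw [gauss_finite (X : ℤ⟦X⟧) (fun s => (1 + X ^ (s + 1)) * ∑' j, (X ^ (s + 1)) ^ j)
    (fun s => ∑' j, (X ^ (s + 1)) ^ j) (fun n => ∏ i ∈ Finset.range n,
      ((1 + (X : ℤ⟦X⟧) ^ (i + 1)) * ∑' j, (X ^ (i + 1)) ^ j))
    (fun s => WithPiTopology.tsum_pow_mul_one_sub_of_constantCoeff_eq_zero (by simp))
    (fun s => rfl) (by simp) (fun s => Finset.prod_range_succ _ _)]
  -- The error terms in the finite identity carry q^((n+1)(s+1)), which is invisible in degree d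
  -- once n ≥ d.
  have hd : X ^ (d + 1) ∣ 2 * ∑ s ∈ Finset.range n, (-1) ^ (s + 1) *
      ((X : ℤ⟦X⟧) ^ (n + 1)) ^ (s + 1) * ((∑' j, (X ^ (s + 1)) ^ j) *
        ∏ i ∈ Finset.range s, ((1 + (X : ℤ⟦X⟧) ^ (i + 1)) * ∑' j, (X ^ (i + 1)) ^ j)) := by
    refine (Finset.dvd_sum fun s _ => ?_).mul_left _
    refine ((?_ : X ^ (d + 1) ∣ ((X : ℤ⟦X⟧) ^ (n + 1)) ^ (s + 1)).mul_left _).mul_right _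
    rw [← pow_mul]
    exact pow_dvd_pow _ (by nlinarith)
  rw [map_add, X_pow_dvd_iff.1 hd d d.lt_succ_self, add_zero]

end Gauss

/-! ### Overcubic partitions as pairs of overpartitions -/

/-- An overpartition: a partition in which the first occurrence of each part may be overlined. -/
@[ext]
structure Overpartition where
  parts : Multiset ℕ
  overlined : Finset ℕ
  parts_pos : ∀ p ∈ parts, 0 < p
  overlined_subset : ∀ p ∈ overlined, p ∈ parts

namespace Overpartition

/-- Overpartitions of `n` are partitions of `n` with a marked set of distinct parts. -/
def fiberEquiv (n : ℕ) : {π : Overpartition // (π.parts.sum : ℤ) = n} ≃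
    Σ p : n.Partition, p.parts.toFinset.powerset where
  toFun π := ⟨⟨π.1.parts, fun {i} hi => π.1.parts_pos i hi, by exact_mod_cast π.2⟩,
    π.1.overlined, by
      rw [Finset.mem_powerset]
      exact fun p hp => Multiset.mem_toFinset.2 (π.1.overlined_subset p hp)⟩
  invFun x := ⟨⟨x.1.parts, x.2.1, fun _ hp => x.1.parts_pos hp, fun _ hp =>
    Multiset.mem_toFinset.1 (Finset.mem_powerset.1 x.2.2 hp)⟩, by rw [x.1.parts_sum]⟩
  left_inv _ := rfl
  right_inv _ := rfl

theorem admissible : Admissible fun π : Overpartition => (π.parts.sum : ℤ) where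
  nonneg _ := Int.natCast_nonneg _
  finite n := Finite.of_equiv _ (fiberEquiv n).symm

theorem theta_eq : theta ℤ (fun π : Overpartition => (π.parts.sum : ℤ)) =
    overpartitionSeries := by
  ext n
  rw [coeff_theta, Nat.card_congr (fiberEquiv n), Nat.card_sigma, overpartitionSeries,
    Nat.Partition.coeff_genFun]
  push_cast
  refine Finset.sum_congr rfl fun p _ => ?_
  -- A partition with k distinct part sizes has 2^k markings, which is the weight in
  -- `overpartitionSeries`.
  rw [Nat.card_eq_fintype_card, Fintype.card_coe, Finset.card_powerset, Finsupp.prod,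
    Finset.prod_const, Multiset.toFinsupp_support]
  norm_cast

end Overpartition

namespace OvercubicPartition

/-- The overcubic partition whose parts of colour `0` are the parts of `x.1` and whose parts of
colour `1` are twice the parts of `x.2`. -/
def ofPair (x : Overpartition × Overpartition) : OvercubicPartition where
  parts := x.1.parts.map (fun p => (p, 0)) + x.2.parts.map fun p => (2 * p, 1)
  overlined := x.1.overlined.image (fun p => (p, 0)) ∪ x.2.overlined.image fun p => (2 * p, 1)
  parts_pos p hp := by
    rcases Multiset.mem_add.1 hp with h | h
    · obtain ⟨a, ha, rfl⟩ := Multiset.mem_map.1 h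
      exact x.1.parts_pos a ha
    · obtain ⟨a, ha, rfl⟩ := Multiset.mem_map.1 h
      exact Nat.mul_pos two_pos (x.2.parts_pos a ha)
  even_of_colour_one p hp h1 := by
    rcases Multiset.mem_add.1 hp with h | h
    · obtain ⟨a, ha, rfl⟩ := Multiset.mem_map.1 h
      simp at h1
    · obtain ⟨a, ha, rfl⟩ := Multiset.mem_map.1 h
      exact even_two_mul a
  overlined_subset p hp := by
    rw [Multiset.mem_add]
    rcases Finset.mem_union.1 hp with h | h
    · obtain ⟨a, ha, rfl⟩ := Finset.mem_image.1 h
      exact Or.inl (Multiset.mem_map_of_mem _ (x.1.overlined_subset a ha))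
    · obtain ⟨a, ha, rfl⟩ := Finset.mem_image.1 h
      exact Or.inr (Multiset.mem_map_of_mem (fun p => ((2 * p, 1) : ℕ × Fin 2))
        (x.2.overlined_subset a ha))

/-- The overpartition formed by the parts of colour `0`. -/
def colourZero (π : OvercubicPartition) : Overpartition where
  parts := (π.parts.filter fun p => p.2 = 0).map Prod.fst
  overlined := (π.overlined.filter fun p => p.2 = 0).image Prod.fst
  parts_pos p hp := by
    obtain ⟨a, ha, rfl⟩ := Multiset.mem_map.1 hp
    exact π.parts_pos a (Multiset.mem_filter.1 ha).1
  overlined_subset p hp := by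
    obtain ⟨a, ha, rfl⟩ := Finset.mem_image.1 hp
    obtain ⟨h1, h2⟩ := Finset.mem_filter.1 ha
    exact Multiset.mem_map_of_mem _ (Multiset.mem_filter.2 ⟨π.overlined_subset a h1, h2⟩)

/-- The overpartition formed by the halves of the parts of colour `1`. -/
def colourOne (π : OvercubicPartition) : Overpartition where
  parts := (π.parts.filter fun p => p.2 = 1).map fun p => p.1 / 2
  overlined := (π.overlined.filter fun p => p.2 = 1).image fun p => p.1 / 2
  parts_pos p hp := by
    obtain ⟨a, ha, rfl⟩ := Multiset.mem_map.1 hp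
    obtain ⟨h1, h2⟩ := Multiset.mem_filter.1 ha
    obtain ⟨b, hb⟩ := π.even_of_colour_one a h1 h2
    have := π.parts_pos a h1
    omega
  overlined_subset p hp := by
    obtain ⟨a, ha, rfl⟩ := Finset.mem_image.1 hp
    obtain ⟨h1, h2⟩ := Finset.mem_filter.1 ha
    exact Multiset.mem_map_of_mem (fun p : ℕ × Fin 2 => p.1 / 2)
      (Multiset.mem_filter.2 ⟨π.overlined_subset a h1, h2⟩)

theorem ofPair_colours (π : OvercubicPartition) : ofPair (π.colourZero, π.colourOne) = π := by
  have hne : ∀ p : ℕ × Fin 2, ¬ p.2 = 0 ↔ p.2 = 1 := fun p => by omega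
  ext1
  · simp only [ofPair, colourZero, colourOne, Multiset.map_map, Function.comp_def]
    conv_rhs => rw [← Multiset.filter_add_not (fun p => p.2 = 0) π.parts]
    congr 1
    · conv_rhs => rw [← Multiset.map_id (Multiset.filter _ _)]
      refine Multiset.map_congr rfl fun p hp => ?_
      exact Prod.ext rfl (Multiset.mem_filter.1 hp).2.symm
    · simp only [hne]
      conv_rhs => rw [← Multiset.map_id (Multiset.filter _ _)]
      refine Multiset.map_congr rfl fun p hp => ?_
      obtain ⟨h1, h2⟩ := Multiset.mem_filter.1 hp
      exact Prod.ext (Nat.two_mul_div_two_of_even (π.even_of_colour_one p h1 h2)) h2.symm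
  · ext p
    simp only [ofPair, colourZero, colourOne, Finset.mem_union, Finset.mem_image,
      Finset.mem_filter]
    constructor
    · rintro (⟨_, ⟨a, ⟨h1, h2⟩, rfl⟩, rfl⟩ | ⟨_, ⟨a, ⟨h1, h2⟩, rfl⟩, rfl⟩)
      · rwa [← h2]
      · rwa [← h2, Nat.two_mul_div_two_of_even
          (π.even_of_colour_one a (π.overlined_subset a h1) h2)]
    · intro hp
      by_cases h : p.2 = 0
      · exact Or.inl ⟨p.1, ⟨p, ⟨hp, h⟩, rfl⟩, Prod.ext rfl h.symm⟩
      · rw [hne] at h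
        exact Or.inr ⟨p.1 / 2, ⟨p, ⟨hp, h⟩, rfl⟩, Prod.ext (Nat.two_mul_div_two_of_even
          (π.even_of_colour_one p (π.overlined_subset p hp) h)) h.symm⟩

theorem colourZero_ofPair (x : Overpartition × Overpartition) : (ofPair x).colourZero = x.1 := by
  ext1
  · simp [ofPair, colourZero, Multiset.filter_map]
  · ext p
    simp [ofPair, colourZero]

theorem colourOne_ofPair (x : Overpartition × Overpartition) : (ofPair x).colourOne = x.2 := by
  ext1
  · simp [ofPair, colourOne, Multiset.filter_map]
  · ext p
    simp [ofPair, colourOne]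

theorem ofPair_bijective : Function.Bijective ofPair :=
  ⟨fun x y h => Prod.ext (by rw [← colourZero_ofPair x, h, colourZero_ofPair])
    (by rw [← colourOne_ofPair x, h, colourOne_ofPair]), fun π => ⟨_, ofPair_colours π⟩⟩

theorem size_ofPair (x : Overpartition × Overpartition) :
    (ofPair x).size = x.1.parts.sum + 2 * x.2.parts.sum := by
  have h : (x.2.parts.map fun p => 2 * p).sum = 2 * x.2.parts.sum := by
    simpa using Multiset.sum_map_mul_left (s := x.2.parts) (a := 2) (f := id)
  simp [ofPair, size, h]

theorem admissible_pair : Admissible fun x : Overpartition × Overpartition =>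
    (x.1.parts.sum : ℤ) + ((2 : ℕ) : ℤ) * (x.2.parts.sum : ℤ) :=
  Overpartition.admissible.add (Overpartition.admissible.const_mul two_ne_zero)

theorem admissible : Admissible fun π : OvercubicPartition => (π.size : ℤ) := by
  have h := admissible_pair.comp_injective (Equiv.ofBijective _ ofPair_bijective).symm
    (Equiv.injective _)
  convert h using 2 with π
  obtain ⟨x, rfl⟩ := ofPair_bijective.2 π
  rw [size_ofPair, Equiv.ofBijective_symm_apply_apply]
  push_cast
  rfl

theorem theta_eq : theta ℤ (fun π : OvercubicPartition => (π.size : ℤ)) =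
    overpartitionSeries * expand 2 two_ne_zero overpartitionSeries := by
  rw [← Overpartition.theta_eq, expand_theta, theta_mul Overpartition.admissible
    (Overpartition.admissible.const_mul two_ne_zero)]
  refine (theta_congr ofPair ofPair_bijective fun x => ?_).symm
  rw [size_ofPair]
  push_cast
  rfl

end OvercubicPartition

theorem coeff_overcubicSeries_pow_three (n : ℕ) :
    coeff n ((overpartitionSeries * expand 2 two_ne_zero overpartitionSeries) ^ (3 : ℕ)) =
      (bt n : ℤ) := by
  rw [← OvercubicPartition.theta_eq, pow_three,
    theta_mul OvercubicPartition.admissible OvercubicPartition.admissible,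
    theta_mul OvercubicPartition.admissible
      (OvercubicPartition.admissible.add OvercubicPartition.admissible), coeff_theta, bt]
  refine congrArg (fun k : ℕ => (k : ℤ)) ?_
  refine Nat.card_congr (Equiv.subtypeEquiv
    { toFun := fun p => ![p.1, p.2.1, p.2.2]
      invFun := fun π => (π 0, π 1, π 2)
      left_inv := fun _ => rfl
      right_inv := fun π => funext fun i => by fin_cases i <;> rfl } fun p => ?_)
  rw [Fin.sum_univ_three]
  change _ ↔ p.1.size + p.2.1.size + p.2.2.size = n
  omega

/-! ### The generating series as a theta product, and its reduction modulo 128 -/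

section ThetaProduct

variable {R : Type*} [CommRing R]

/-- This is φ(q)φ(-q) = φ(-q²)², stated through the reciprocals supplied by Gauss's theorem. -/
theorem overpartitionSeries_eq :
    overpartitionSeries = squareSeries ℤ 1 * expand 2 two_ne_zero overpartitionSeries ^ 2 := by
  have h := overpartitionSeries_mul
  have h2 := congrArg (expand 2 two_ne_zero) h
  have e1 : expand 2 two_ne_zero (squareSeries ℤ 4) = squareSeries ℤ 8 := by
    rw [squareSeries, squareSeries, expand_theta]
    congr 1; funext i; push_cast; ring
  have e2 : expand 2 two_ne_zero (oddSquareSeries ℤ 1) = oddSquareSeries ℤ 2 := by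
    rw [oddSquareSeries, oddSquareSeries, expand_theta]
    congr 1; funext i; push_cast; ring
  rw [map_mul, map_sub, map_mul, map_ofNat, map_one, e1, e2] at h2
  have t1 := squareSeries_eq (R := ℤ) one_pos
  have t2 := squareSeries_sq (R := ℤ) two_pos
  have t3 := oddSquareSeries_sq (R := ℤ) one_pos
  norm_num at t1 t2 t3
  set P := overpartitionSeries
  set P2 := expand 2 two_ne_zero P
  set A := squareSeries ℤ 4
  set b := oddSquareSeries ℤ 1
  set c := squareSeries ℤ 8
  set d := oddSquareSeries ℤ 2
  rw [t1]
  have h3 : (A + 2 * b) * (A - 2 * b) = (c - 2 * d) ^ 2 := by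
    linear_combination t2 - 4 * t3
  linear_combination -P * ((c - 2 * d) * P2 + 1) * h2 + P * P2 ^ 2 * h3 * (-1) +
    P2 ^ 2 * (A + 2 * b) * h

theorem expand_overpartitionSeries_eq (k : ℕ) (hk : k ≠ 0) (hk2 : k * 2 ≠ 0) :
    expand k hk overpartitionSeries =
      squareSeries ℤ k * expand (k * 2) hk2 overpartitionSeries ^ 2 := by
  conv_lhs => rw [overpartitionSeries_eq]
  rw [map_mul, map_pow, ← expand_mul, squareSeries, squareSeries, expand_theta]
  congr 2
  funext i
  push_cast
  ring

theorem overcubicSeries_pow_three_eq :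
    (overpartitionSeries * expand 2 two_ne_zero overpartitionSeries) ^ 3 =
      squareSeries ℤ 1 ^ 3 * squareSeries ℤ 2 ^ 9 * squareSeries ℤ 4 ^ 18 *
        expand 8 (by norm_num) overpartitionSeries ^ 36 := by
  have h1 := overpartitionSeries_eq
  have h2 : expand 2 two_ne_zero overpartitionSeries =
      squareSeries ℤ 2 * expand 4 (by norm_num) overpartitionSeries ^ 2 :=
    expand_overpartitionSeries_eq 2 _ (by norm_num)
  have h4 : expand 4 (by norm_num) overpartitionSeries =
      squareSeries ℤ 4 * expand 8 (by norm_num) overpartitionSeries ^ 2 :=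
    expand_overpartitionSeries_eq 4 _ (by norm_num)
  generalize expand 8 _ overpartitionSeries = P8 at *
  generalize expand 4 _ overpartitionSeries = P4 at *
  generalize expand 2 _ overpartitionSeries = P2 at *
  rw [h1, h2, h4]
  ring

/-- With C = φ(q⁸), the left side times b is the part of φ(q)³φ(q²)⁹φ(q⁴)¹⁸ with odd exponents.
Modulo 128 only powers of d up to the fifth survive. -/
theorem eight_residue_polynomial (h : (128 : R) = 0) (C d : R) :
    (C ^ 2 + 4 * d ^ 2) ^ 9 * (C + 2 * d) ^ 9 * (6 * C ^ 2 + 8 * C * d + 24 * d ^ 2) =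
      6 * C ^ 29 + 116 * C ^ 28 * d + 1248 * C ^ 27 * d ^ 2 + 64 * C ^ 26 * d ^ 3 +
        96 * C ^ 25 * d ^ 4 + 64 * C ^ 24 * d ^ 5 := by
  linear_combination (76 * C ^ 26 * d ^ 3 + 480 * C ^ 25 * d ^ 4 + 2542 * C ^ 24 * d ^ 5 +
      11664 * C ^ 23 * d ^ 6 + 47328 * C ^ 22 * d ^ 7 + 172188 * C ^ 21 * d ^ 8 +
      567240 * C ^ 20 * d ^ 9 + 1704128 * C ^ 19 * d ^ 10 + 4693632 * C ^ 18 * d ^ 11 +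
      11897280 * C ^ 17 * d ^ 12 + 27827328 * C ^ 16 * d ^ 13 + 60162048 * C ^ 15 * d ^ 14 +
      120324096 * C ^ 14 * d ^ 15 + 222618624 * C ^ 13 * d ^ 16 + 380712960 * C ^ 12 * d ^ 17 +
      600784896 * C ^ 11 * d ^ 18 + 872513536 * C ^ 10 * d ^ 19 + 1161707520 * C ^ 9 * d ^ 20 +
      1410564096 * C ^ 8 * d ^ 21 + 1550843904 * C ^ 7 * d ^ 22 + 1528823808 * C ^ 6 * d ^ 23 +
      1333002240 * C ^ 5 * d ^ 24 + 1008205824 * C ^ 4 * d ^ 25 + 641728512 * C ^ 3 * d ^ 26 +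
      327155712 * C ^ 2 * d ^ 27 + 121634816 * C ^ 1 * d ^ 28 + 25165824 * C ^ 0 * d ^ 29) * h

theorem thirtyTwo_mul_pow {x : R} (hx : 32 * x = 32) (n : ℕ) :
    32 * x ^ n = 32 := by
  induction n with
  | zero => simp
  | succ n ih => rw [pow_succ, ← mul_assoc, ih, hx]

/-- The terms of the generating function whose exponent is `5` modulo `8`. -/
theorem coeff_thetaProduct (h : (128 : R) = 0) {p y : R⟦X⟧} (hp : SupportedMod 8 0 p)
    (hpy : p * (1 + 2 * y) = 1) {n : ℕ} (hn : (n : ZMod 8) = 5) :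
    coeff n (squareSeries R 1 ^ 3 * squareSeries R 2 ^ 9 * squareSeries R 4 ^ 18 * p ^ 36) =
      39 * 32 * coeff n (oddSquareSeries R 1 ^ 3 * oddSquareSeries R 2) := by
  have h' : (128 : R⟦X⟧) = 0 := by
    rw [show (128 : R⟦X⟧) = C (128 : R) from (map_ofNat _ 128).symm, h, map_zero]
  have hn2 : (n : ZMod 2) = 1 := by
    have := congrArg (ZMod.castHom (show 2 ∣ 8 by norm_num) (ZMod 2)) hn
    rw [map_natCast] at this
    rw [this]; decide
  have hA : SupportedMod 2 0 (squareSeries R 4) := .theta fun i => by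
    push_cast; generalize (i : ZMod 2) = x; revert x; decide
  have hb : SupportedMod 8 1 (oddSquareSeries R 1) := .theta fun i => by
    push_cast; generalize (i : ZMod 8) = x; revert x; decide
  have hb2 : SupportedMod 2 1 (oddSquareSeries R 1) := .theta fun i => by
    push_cast; generalize (i : ZMod 2) = x; revert x; decide
  have hC : SupportedMod 8 0 (squareSeries R 8) := .theta fun i => by
    push_cast; generalize (i : ZMod 8) = x; revert x; decide
  have hC2 : SupportedMod 2 0 (squareSeries R 8) := .theta fun i => by
    push_cast; generalize (i : ZMod 2) = x; revert x; decide
  have hd : SupportedMod 8 2 (oddSquareSeries R 2) := .theta fun i => by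
    push_cast; generalize (i : ZMod 8) = x; revert x; decide
  have hd2 : SupportedMod 2 0 (oddSquareSeries R 2) := .theta fun i => by
    push_cast; generalize (i : ZMod 2) = x; revert x; decide
  have hp2 : SupportedMod 2 0 p := fun m hm => hp m fun h0 => hm (by
    have := congrArg (ZMod.castHom (show 2 ∣ 8 by norm_num) (ZMod 2)) h0
    rwa [map_natCast, map_zero] at this)
  have t1 := squareSeries_eq (R := R) one_pos
  have t1' := squareSeries_eq (R := R) two_pos
  have t2 := squareSeries_sq (R := R) two_pos
  have t3 := oddSquareSeries_sq (R := R) one_pos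
  obtain ⟨s, hs⟩ : ∃ s, squareSeries R 8 = 1 + 2 * s := ⟨_, squareSeries_eq_one_add (by norm_num)⟩
  norm_num at t1 t1' t2 t3
  set A := squareSeries R 4
  set b := oddSquareSeries R 1
  set c := squareSeries R 8
  set d := oddSquareSeries R 2
  -- The square of 1 + 2s is 1 modulo 4, so 32 absorbs it modulo 128; the same holds for `p`, an
  -- inverse of such a series.
  have hc32 : 32 * c ^ 2 = 32 := by
    rw [hs]; linear_combination (s + s ^ 2) * h'
  have hp32 : 32 * p ^ 2 = 32 := by
    linear_combination 32 * (p * (1 + 2 * y) + 1) * hpy - p ^ 2 * (y + y ^ 2) * h'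
  -- The groups have exponents that are even, then 1, 3, 7 and 5 modulo 8. The last is
  -- 1248·b·c²⁷·d²·p³⁶, where 1248 = 39·32 lets c²⁶ and p³⁶ drop out and b² = cd turns b·c·d² into
  -- b³d.
  have key : squareSeries R 1 ^ 3 * squareSeries R 2 ^ 9 * A ^ 18 * p ^ 36 =
      A ^ 18 * (A * (A ^ 2 + ((12 : ℕ) : R⟦X⟧) * b ^ 2)) * (c + ((2 : ℕ) : R⟦X⟧) * d) ^ 9 * p ^ 36 +
      (((6 : ℕ) : R⟦X⟧) * (b * c ^ 29 * p ^ 36) + ((96 : ℕ) : R⟦X⟧) * (b * c ^ 25 * d ^ 4 * p ^ 36)) +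
      (((116 : ℕ) : R⟦X⟧) * (b * c ^ 28 * d * p ^ 36) + ((64 : ℕ) : R⟦X⟧) * (b * c ^ 24 * d ^ 5 * p ^ 36)) +
      ((64 : ℕ) : R⟦X⟧) * (b * c ^ 26 * d ^ 3 * p ^ 36) + ((39 * 32 : ℕ) : R⟦X⟧) * (b ^ 3 * d) := by
    have e1 : 32 * (c ^ 2) ^ 13 = 32 := thirtyTwo_mul_pow hc32 13
    have e2 : 32 * (p ^ 2) ^ 18 = 32 := thirtyTwo_mul_pow hp32 18
    have e3 := eight_residue_polynomial h' c d
    have e4 : A ^ 18 * (6 * A ^ 2 + 8 * b ^ 2) =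
        (c ^ 2 + 4 * d ^ 2) ^ 9 * (6 * c ^ 2 + 8 * c * d + 24 * d ^ 2) := by
      rw [show A ^ 18 = (A ^ 2) ^ 9 by ring, t2, t3]; ring
    rw [t1, t1']
    push_cast
    linear_combination b * (c + 2 * d) ^ 9 * p ^ 36 * e4 + b * p ^ 36 * e3 +
      39 * b * c * d ^ 2 * p ^ 36 * e1 + 39 * b * c * d ^ 2 * e2 - 39 * 32 * b * d * t3
  have z0 : coeff n (A ^ 18 * (A * (A ^ 2 + ((12 : ℕ) : R⟦X⟧) * b ^ 2)) * (c + ((2 : ℕ) : R⟦X⟧) * d) ^ 9 * p ^ 36) =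
      0 := by
    refine ((((hA.pow 18).mul (hA.mul (((hA.pow 2).congr (s := 0) (by decide)).add
      (((hb2.pow 2).natCast_mul 12).congr (by decide))))).mul
      ((hC2.add (hd2.natCast_mul 2)).pow 9)).mul (hp2.pow 36)) n ?_
    rw [hn2]; decide
  have z1 := (((hb.mul (hC.pow 29)).mul (hp.pow 36)).natCast_mul 6 |>.congr (s := 1)
    (by decide)).add ((((hb.mul (hC.pow 25)).mul (hd.pow 4)).mul (hp.pow 36)).natCast_mul 96
    |>.congr (by decide)) n (by rw [hn]; decide)
  have z2 := ((((hb.mul (hC.pow 28)).mul hd).mul (hp.pow 36)).natCast_mul 116 |>.congr (s := 3)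
    (by decide)).add ((((hb.mul (hC.pow 24)).mul (hd.pow 5)).mul (hp.pow 36)).natCast_mul 64
    |>.congr (by decide)) n (by rw [hn]; decide)
  have z3 := (((hb.mul (hC.pow 26)).mul (hd.pow 3)).mul (hp.pow 36)).natCast_mul 64 n
    (by rw [hn]; decide)
  rw [key, map_add, map_add, map_add, map_add, z0, z1, z2, z3, ← map_natCast (C (R := R)),
    coeff_C_mul]
  push_cast
  ring

end ThetaProduct

/-! ### The congruences modulo 128 and modulo 3 -/

theorem dvd_bt_of_mod_eight_of_mod_nine {n : ℕ} (hn : n % 8 = 5) (hn' : n % 9 = 3 ∨ n % 9 = 6) :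
    128 ∣ bt n := by
  have h8 : (n : ZMod 8) = 5 := (ZMod.natCast_eq_natCast_iff' n 5 8).2 hn
  have h9 : (n : ZMod 9) = 3 ∨ (n : ZMod 9) = 6 :=
    hn'.imp (ZMod.natCast_eq_natCast_iff' n 3 9).2 (ZMod.natCast_eq_natCast_iff' n 6 9).2
  have hmap : ∀ (m : ℕ) (k : ℕ),
      PowerSeries.map (Int.castRingHom (ZMod m)) (squareSeries ℤ k) = squareSeries (ZMod m) k :=
    fun m k => map_theta _ _
  have hmap' : ∀ (m : ℕ) (k : ℕ), PowerSeries.map (Int.castRingHom (ZMod m))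
      (oddSquareSeries ℤ k) = oddSquareSeries (ZMod m) k := fun m k => map_theta _ _
  -- This factor 4 is computed over ZMod 4 and lifted to ℤ, so that it can meet the factor 32 in
  -- ZMod 128.
  obtain ⟨z, hz⟩ : (4 : ℤ) ∣ coeff n (oddSquareSeries ℤ 1 ^ 3 * oddSquareSeries ℤ 2) := by
    refine (ZMod.intCast_zmod_eq_zero_iff_dvd _ 4).1 ?_
    rw [← eq_intCast (Int.castRingHom (ZMod 4)), ← coeff_map,
      map_mul, map_pow, hmap', hmap']
    exact coeff_oddSquareSeries_cube_mul (by decide) h9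
  have hmod : ((coeff n ((overpartitionSeries * expand 2 two_ne_zero overpartitionSeries) ^ 3) : ℤ) :
      ZMod 128) = 0 := by
    obtain ⟨y, hy⟩ : ∃ y : ℤ⟦X⟧, squareSeries ℤ 4 - 2 * oddSquareSeries ℤ 1 = 1 + 2 * y :=
      ⟨_, by rw [squareSeries_eq_one_add four_pos, add_sub_assoc, ← mul_sub]⟩
    have hP := congrArg (expand 8 (by norm_num)) overpartitionSeries_mul
    rw [hy, map_mul, map_add, map_one, map_mul, map_ofNat] at hP
    have hP' := congrArg (PowerSeries.map (Int.castRingHom (ZMod 128))) hP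
    rw [map_mul, map_add, map_one, map_mul, map_ofNat, map_expand, map_expand, mul_comm] at hP'
    have h128 : (128 : ZMod 128) = 0 := ZMod.natCast_self 128
    have h3 := coeff_thetaProduct h128
      (SupportedMod.expand (by norm_num) (dvd_refl 8)) hP' h8
    rw [← eq_intCast (Int.castRingHom (ZMod 128)), ← coeff_map, overcubicSeries_pow_three_eq]
    simp only [map_mul, map_pow, hmap, map_expand]
    have hz' : coeff n (oddSquareSeries (ZMod 128) 1 ^ 3 * oddSquareSeries (ZMod 128) 2) =
        4 * (z : ZMod 128) := by
      rw [← hmap', ← hmap', ← map_pow, ← map_mul, coeff_map, hz, eq_intCast, Int.cast_mul,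
        Int.cast_ofNat]
    refine h3.trans ?_
    rw [hz']
    linear_combination 39 * (z : ZMod 128) * h128
  rw [coeff_overcubicSeries_pow_three] at hmod
  exact (ZMod.natCast_eq_zero_iff _ _).1 (by exact_mod_cast hmod)

theorem pow_three_eq_expand (f : (ZMod 3)⟦X⟧) : f ^ 3 = expand 3 three_ne_zero f := by
  have h := MvPowerSeries.map_frobenius_expand (R := ZMod 3) 3 three_ne_zero (f := f)
  rw [← h, ZMod.frobenius_zmod, MvPowerSeries.map_id]
  rfl

theorem three_dvd_bt {n : ℕ} (hn : n % 9 = 6) : 3 ∣ bt n := by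
  obtain ⟨m, rfl⟩ : ∃ m, n = 3 * m := ⟨n / 3, by omega⟩
  have hm : (m : ZMod 3) = 2 := (ZMod.natCast_eq_natCast_iff' m 2 3).2 (by omega)
  have hmod : ((coeff (3 * m)
      ((overpartitionSeries * expand 2 two_ne_zero overpartitionSeries) ^ 3) : ℤ) : ZMod 3) = 0 := by
    rw [← eq_intCast (Int.castRingHom (ZMod 3)), ← coeff_map, map_pow, pow_three_eq_expand, coeff_expand_mul]
    -- This form exposes a second cube, which modulo 3 has only exponents divisible by 3; the class
    -- of m is then decided by φ(q) alone.
    have h : overpartitionSeries * expand 2 two_ne_zero overpartitionSeries =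
        squareSeries ℤ 1 * expand 2 two_ne_zero overpartitionSeries ^ 3 := by
      linear_combination expand 2 two_ne_zero overpartitionSeries * overpartitionSeries_eq
    rw [h, map_mul, map_pow, pow_three_eq_expand, squareSeries, map_theta, coeff_mul]
    refine Finset.sum_eq_zero fun x hx => ?_
    by_cases h3 : 3 ∣ x.2
    · have hx1 : (x.1 : ZMod 3) = 2 := by
        rw [← hm, ← Finset.HasAntidiagonal.mem_antidiagonal.1 hx, Nat.cast_add,
          (ZMod.natCast_eq_zero_iff _ _).2 h3, add_zero]
      have : IsEmpty {i : ℤ // ((1 : ℕ) : ℤ) * i ^ 2 = x.1} := ⟨fun i => by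
        have hi := congrArg (Int.cast : ℤ → ZMod 3) i.2
        push_cast at hi
        rw [hx1] at hi
        generalize (i.1 : ZMod 3) = y at hi
        revert y
        decide⟩
      rw [coeff_theta, Nat.card_of_isEmpty, Nat.cast_zero, zero_mul]
    · rw [coeff_expand_of_not_dvd _ _ _ h3, mul_zero]
  rw [coeff_overcubicSeries_pow_three] at hmod
  exact (ZMod.natCast_eq_zero_iff _ _).1 (by exact_mod_cast hmod)

theorem theorem2 (n : ℕ) :
    bt (72 * n + 21) ≡ 0 [MOD 128] ∧ bt (72 * n + 69) ≡ 0 [MOD 384] := by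
  constructor
  · exact (Nat.modEq_zero_iff_dvd).2 (dvd_bt_of_mod_eight_of_mod_nine (by omega) (by omega))
  · refine (Nat.modEq_zero_iff_dvd).2 ?_
    have h1 := dvd_bt_of_mod_eight_of_mod_nine (n := 72 * n + 69) (by omega) (by omega)
    have h2 := three_dvd_bt (n := 72 * n + 69) (by omega)
    exact Nat.Coprime.mul_dvd_of_dvd_of_dvd (by norm_num) h1 h2
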